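/- A left brace is an abelian group $(A,+)$ with a multiplication $\cdot$ satisfying $a\cdot(b+c)=a\cdot b+a\cdot c$ for all $a,b,c\in A$, such that the operation $a\circ b=a\cdot b+a+b$ makes $A$ into a group. Its socle is $\mathrm{Soc}(A)=\{a\in A: a\cdot b=0 \text{ for all } b\in A\}$. Put $A^{(1)}=A$ and let $A^{(n+1)}=A^{(n)}\cdot A$ be the additive subgroup of $A$ generated by all products $a\cdot b$ with $a\in A^{(n)}$, $b\in A$; the left brace $A$ has finite multipermutation level if $A^{(n)}=0$ for some $n\ge 1$. Let $A$ be a finite left brace whose cardinality is cube-free, that is, not divisible by $p^3$ for any prime $p$. If $A\neq 0$, then $\mathrm{Soc}(A)\neq 0$. Moreover, $A$ has finite multipermutation level. -/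

import Mathlib

/-- A left brace: an abelian group with a left distributive multiplication `*` (not assumed
associative or right distributive) such that the circle operation `a ∘ b = a * b + a + b`
makes `A` into a group. -/
class LeftBrace (A : Type*) extends AddCommGroup A, Mul A where
  left_distributive : ∀ a b c : A, a * (b + c) = a * b + a * c
  circ_assoc : ∀ a b c : A,
    (a * b + a + b) * c + (a * b + a + b) + c = a * (b * c + b + c) + a + (b * c + b + c)
  circ_identity_inverse : ∃ e : A, (∀ a : A, e * a + e + a = a ∧ a * e + a + e = a) ∧
    ∀ a : A, ∃ b : A, a * b + a + b = e ∧ b * a + b + a = e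

namespace LeftBrace

/-- The socle `Soc(A) = {a ∈ A : a * b = 0 for all b ∈ A}`. -/
def socle (A : Type*) [LeftBrace A] : Set A :=
  {a | ∀ b : A, a * b = 0}

/-- The right radical chain. With the usual indexing `A^(1) = A`, `A^(n+1) = A^(n) * A`
(the additive subgroup generated by the products), `rightChain A n` is `A^(n+1)`. -/
def rightChain (A : Type*) [LeftBrace A] : ℕ → AddSubgroup A
  | 0 => ⊤
  | n + 1 => AddSubgroup.closure {x | ∃ a ∈ rightChain A n, ∃ b : A, x = a * b}

/-- `A` has finite multipermutation level if `A^(n) = 0` for some `n ≥ 1`. -/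
def HasFiniteMultipermutationLevel (A : Type*) [LeftBrace A] : Prop :=
  ∃ n : ℕ, rightChain A n = ⊥

end LeftBrace

/-- A natural number is cube-free if it is not divisible by the cube of a prime. -/
def CubeFree (n : ℕ) : Prop :=
  ∀ p : ℕ, p.Prime → ¬ p ^ 3 ∣ n

/-! The adjoint group acts on `(A, +)` by `x • a = x * a + a`, with kernel the socle, and preserves
each primary component `A_q`, of order at most `q ^ 2`. Let `p` be the largest prime divisor of
`|A|`. Then `A_p` is also a subgroup of the adjoint group, and some `s ≠ 1` in it acts trivially on
`A_p` (`exists_ne_one_smul_eq_of_card_eq`). For `q < p`, counting fixed points modulo `p` shows that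
`s` is trivial on `A_q` too, unless `q = 2`, `p = 3` and `|A_2| = 4`.

In that case, if the socle were zero, the kernel `M` of the action on `A_3` would be faithful on
`A_2`, so `|M| ≤ 6`. Hence `M ∩ A_3`, which contains `s`, has index at most 2 in `M` and contains
every odd-order element of `M`, in particular the conjugates of `s`. This forces `s` to fix `A_2`, a
contradiction.

Finite multipermutation level follows by induction on `|A|`, passing to the quotient by the socle.
-/

/-! ### Actions of `p`-groups on small abelian groups. -/

theorem smul_eq_of_isPGroup_of_card_le_sq {H B : Type*} [Group H] [AddCommGroup B] [Finite B]
    [DistribMulAction H B] {p q k : ℕ} [Fact p.Prime] (hq : q.Prime) (hqp : q < p)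
    (hH : IsPGroup p H) (hB : Nat.card B = q ^ k) (hk : k ≤ 2)
    (hex : ¬ (q = 2 ∧ p = 3 ∧ k = 2)) (h : H) (b : B) : h • b = b := by
  have hp : p.Prime := Fact.out
  have hmod := hH.card_modEq_card_fixedPoints B
  have hcard : Nat.card (MulAction.fixedPoints H B) =
      Nat.card (FixedPoints.addSubgroup H B) := rfl
  have hdvd := AddSubgroup.card_addSubgroup_dvd_card (FixedPoints.addSubgroup H B)
  rw [hcard] at hmod
  suffices hT : FixedPoints.addSubgroup H B = ⊤ by
    have : b ∈ FixedPoints.addSubgroup H B := hT ▸ AddSubgroup.mem_top b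
    exact this h
  apply AddSubgroup.eq_top_of_card_eq
  rw [hB] at hdvd hmod ⊢
  obtain ⟨j, hj, hjc⟩ := (Nat.dvd_prime_pow hq).1 hdvd
  rw [hjc] at hmod ⊢
  have hd := (Nat.modEq_iff_dvd' (Nat.pow_le_pow_right hq.pos hj)).1 hmod.symm
  have h2 := hq.two_le
  have hnot : ∀ m, 0 < m → m < p → ¬ p ∣ m := fun m h0 hm hd =>
    absurd (Nat.le_of_dvd h0 hd) (by omega)
  -- If `j < k`, then `p` divides `q - 1`, `q ^ 2 - 1` or `q ^ 2 - q`.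
  interval_cases k <;> interval_cases j <;> simp only [pow_zero, pow_one] at hd ⊢
  · exact absurd hd (hnot _ (by omega) (by omega))
  · exfalso
    have e : q ^ 2 - 1 = (q + 1) * (q - 1) := by
      simpa using Nat.sq_sub_sq q 1
    rw [e, hp.dvd_mul] at hd
    rcases hd with hd | hd
    -- Consecutive primes can only be 2 and 3, the excluded case.
    · have : p = q + 1 := le_antisymm (Nat.le_of_dvd (by omega) hd) hqp
      subst this
      rcases hq.eq_two_or_odd' with h | h
      · exact hex ⟨h, by omega, rfl⟩
      · have := (hp.eq_two_or_odd').resolve_left (by omega)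
        rw [Nat.odd_iff] at *
        omega
    · exact hnot _ (by omega) (by omega) hd
  · exfalso
    have e : q ^ 2 - q = q * (q - 1) := by
      rw [Nat.mul_sub, mul_one, sq]
    rw [e, hp.dvd_mul] at hd
    rcases hd with hd | hd
    · exact hnot _ (by omega) hqp hd
    · exact hnot _ (by omega) (by omega) hd

theorem exists_ne_one_smul_eq_of_card_eq {H B : Type*} [Group H] [AddCommGroup B] [Finite B]
    [Finite H] [DistribMulAction H B] {p k : ℕ} [Fact p.Prime] (hH : Nat.card H = p ^ k)
    (hB : Nat.card B = p ^ k) (hk : k ≠ 0) (hk2 : k ≤ 2) : ∃ h : H, h ≠ 1 ∧ ∀ b : B, h • b = b := by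
  have hp : p.Prime := Fact.out
  have hdvd : p ∣ Nat.card B := hB ▸ dvd_pow_self p hk
  have : Nontrivial H := by
    rw [← Finite.one_lt_card_iff_nontrivial, hH]
    exact Nat.one_lt_pow hk hp.one_lt
  by_cases hT : FixedPoints.addSubgroup H B = ⊤
  · obtain ⟨h, hh⟩ := exists_ne (1 : H)
    refine ⟨h, hh, fun b => ?_⟩
    have : b ∈ FixedPoints.addSubgroup H B := hT ▸ AddSubgroup.mem_top b
    exact this h
  obtain ⟨b, hb⟩ : ∃ b, b ∉ FixedPoints.addSubgroup H B := by
    by_contra! hcon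
    exact hT (eq_top_iff.2 fun x _ => hcon x)
  have hmod := (IsPGroup.of_card hH).card_modEq_card_fixedPoints B
  have hF : p ∣ Nat.card (FixedPoints.addSubgroup H B) :=
    (Nat.modEq_zero_iff_dvd.1 (hmod.symm.trans (Nat.modEq_zero_iff_dvd.2 hdvd)))
  -- With a trivial stabilizer the orbit of `b` would have `|H| = |B|` elements, hence contain 0, so
  -- `b = 0` would be fixed.
  have hstab : ∃ h : H, h ≠ 1 ∧ h • b = b := by
    by_contra! hcon
    have hinj : Function.Injective fun h : H => h • b := by
      intro x y hxy
      by_contra hne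
      refine hcon (y⁻¹ * x) (fun h => hne (inv_mul_eq_one.1 h).symm) ?_
      rw [mul_smul]
      exact inv_smul_eq_iff.2 hxy
    have hbij := (Nat.bijective_iff_injective_and_card _).2 ⟨hinj, hH.trans hB.symm⟩
    obtain ⟨h, hh⟩ := hbij.2 0
    have hb0 : b = 0 := by
      have : h • b = h • (0 : B) := by simpa using hh
      exact smul_left_cancel h this
    exact hb (hb0 ▸ zero_mem _)
  obtain ⟨h, h1, hh⟩ := hstab
  refine ⟨h, h1, ?_⟩
  let K : AddSubgroup B := (DistribSMul.toAddMonoidHom B h).eqLocus (AddMonoidHom.id B)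
  -- The common fixed points already number at least `p`, so the strictly larger `K` has order at
  -- least `p ^ 2`.
  have hFK : FixedPoints.addSubgroup H B < K := by
    refine lt_of_le_of_ne (fun x hx => hx h) fun heq => hb ?_
    rw [heq]
    exact hh
  suffices hK : K = ⊤ from fun x => (hK ▸ AddSubgroup.mem_top x : x ∈ K)
  apply AddSubgroup.eq_top_of_card_eq
  have hKd := AddSubgroup.card_addSubgroup_dvd_card K
  have hle : Nat.card (FixedPoints.addSubgroup H B) < Nat.card K :=
    Set.Finite.card_lt_card (Set.toFinite _) hFK
  rw [hB] at hKd ⊢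
  obtain ⟨j, hj, hjc⟩ := (Nat.dvd_prime_pow hp).1 hKd
  rw [hjc] at hle ⊢
  have h1j : 1 < j := by
    have : p ^ 1 < p ^ j := by
      rw [pow_one]
      exact (Nat.le_of_dvd Nat.card_pos hF).trans_lt hle
    exact (Nat.pow_lt_pow_iff_right hp.one_lt).1 this
  congr 1
  omega

/-! ### The adjoint group and its action. -/

namespace LeftBrace

/-- The adjoint group `(A, ∘)` of a left brace. -/
def Adjoint (A : Type*) := A

variable {A : Type*} [LeftBrace A]

theorem mul_zero' (a : A) : a * 0 = 0 := by
  have := left_distributive a 0 0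
  rwa [add_zero, left_eq_add] at this

theorem zero_mul' (a : A) : (0 : A) * a = 0 := by
  obtain ⟨e, he, -⟩ := circ_identity_inverse (A := A)
  have h0 : e = 0 := by simpa [mul_zero'] using (he 0).1
  simpa [h0] using (he a).1

theorem exists_circ_inverse (a : A) : ∃ b : A, b * a + b + a = 0 := by
  obtain ⟨e, he, hi⟩ := circ_identity_inverse (A := A)
  have h0 : e = 0 := by simpa [mul_zero'] using (he 0).1
  obtain ⟨b, -, hb⟩ := hi a
  exact ⟨b, h0 ▸ hb⟩

namespace Adjoint

/-- The identity map from the adjoint group to the brace. -/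
def val (x : Adjoint A) : A := x

/-- The identity map from the brace to the adjoint group. -/
def of (a : A) : Adjoint A := a

noncomputable instance : Group (Adjoint A) :=
  letI : Mul (Adjoint A) := ⟨fun x y => of (val x * val y + val x + val y)⟩
  letI : One (Adjoint A) := ⟨of 0⟩
  letI : Inv (Adjoint A) := ⟨fun x => of (exists_circ_inverse (val x)).choose⟩
  Group.ofLeftAxioms (fun a b c => circ_assoc (val a) (val b) (val c))
    (fun a => by
      change (0 : A) * val a + 0 + val a = val a
      rw [zero_mul', zero_add, zero_add])
    (fun a => (exists_circ_inverse (val a)).choose_spec)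

instance : SMul (Adjoint A) A := ⟨fun x a => val x * a + a⟩

theorem smul_def (x : Adjoint A) (a : A) : x • a = val x * a + a := rfl

/-- The cocycle identity: it links the two group structures in all later computations. -/
theorem val_mul (x y : Adjoint A) : val (x * y) = val x + x • val y := by
  change val x * val y + val x + val y = val x + (val x * val y + val y)
  abel

theorem val_one : val (1 : Adjoint A) = 0 := rfl

instance : DistribMulAction (Adjoint A) A where
  one_smul a := by rw [smul_def, val_one, zero_mul', zero_add]
  mul_smul x y a := by
    have h := circ_assoc (val x) (val y) a
    rw [left_distributive, left_distributive] at h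
    rw [smul_def, smul_def, smul_def, left_distributive]
    change (val x * val y + val x + val y) * a + a = _
    have h' : (val x * val y + val x + val y) * a + a + (val x * val y + val x + val y)
        = val x * (val y * a) + val x * a + (val y * a + a) +
          (val x * val y + val x + val y) := by
      rw [add_right_comm, h]
      abel
    exact add_right_cancel h'
  smul_zero x := by rw [smul_def, mul_zero', zero_add]
  smul_add x a b := by
    rw [smul_def, smul_def, smul_def, left_distributive]
    abel

theorem mem_socle_iff (x : Adjoint A) : val x ∈ socle A ↔ ∀ a : A, x • a = a := by
  simp only [smul_def, add_eq_right]
  rfl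

theorem val_inv (x : Adjoint A) : val x⁻¹ = -(x⁻¹ • val x) := by
  rw [eq_neg_iff_add_eq_zero, ← val_mul, inv_mul_cancel, val_one]

instance [Finite A] : Finite (Adjoint A) := inferInstanceAs (Finite A)

/-- A left ideal of a brace, viewed as a subgroup of the adjoint group. -/
def ofLeftIdeal (I : AddSubgroup A) (hI : ∀ (x : Adjoint A), ∀ a ∈ I, x • a ∈ I) :
    Subgroup (Adjoint A) where
  carrier := {x | val x ∈ I}
  mul_mem' {x y} hx hy := by
    rw [Set.mem_ofPred_eq, val_mul]
    exact add_mem hx (hI x _ hy)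
  one_mem' := zero_mem I
  inv_mem' {x} hx := by
    rw [Set.mem_ofPred_eq, val_inv]
    exact neg_mem (hI _ _ hx)

end Adjoint

end LeftBrace

/-! ### Primary components. -/

/-- The elements of an abelian group killed by a power of `q`. -/
def powTorsion (A : Type*) [AddCommGroup A] (q : ℕ) : AddSubgroup A where
  carrier := {a | ∃ k : ℕ, q ^ k • a = 0}
  zero_mem' := ⟨0, smul_zero _⟩
  add_mem' := by
    rintro a b ⟨k, hk⟩ ⟨l, hl⟩
    refine ⟨k + l, ?_⟩
    rw [smul_add, pow_add, mul_smul, mul_smul, hl, smul_comm, hk, smul_zero, smul_zero, add_zero]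
  neg_mem' := by
    rintro a ⟨k, hk⟩
    exact ⟨k, by rw [smul_neg, hk, neg_zero]⟩

theorem smul_mem_powTorsion {A H : Type*} [AddCommGroup A] [Monoid H] [DistribMulAction H A]
    {q : ℕ} (h : H) {a : A} (ha : a ∈ powTorsion A q) : h • a ∈ powTorsion A q := by
  obtain ⟨k, hk⟩ := ha
  exact ⟨k, by rw [smul_comm, hk, smul_zero]⟩

theorem exists_card_powTorsion {A : Type*} [AddCommGroup A] [Finite A] {q : ℕ} (hq : q.Prime) :
    ∃ k : ℕ, Nat.card (powTorsion A q) = q ^ k := by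
  have := Fact.mk hq
  have h : IsPGroup q (Multiplicative (powTorsion A q)) := by
    intro x
    obtain ⟨k, hk⟩ := (Multiplicative.toAdd x).2
    exact ⟨k, Multiplicative.toAdd.injective (Subtype.ext hk)⟩
  exact (IsPGroup.iff_card (G := Multiplicative (powTorsion A q))).1 h

theorem exists_card_powTorsion_of_cubeFree {A : Type*} [AddCommGroup A] [Finite A]
    (hA : CubeFree (Nat.card A)) {q : ℕ} (hq : q.Prime) :
    ∃ k ≤ 2, Nat.card (powTorsion A q) = q ^ k := by
  obtain ⟨k, hk⟩ := exists_card_powTorsion (A := A) hq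
  refine ⟨k, ?_, hk⟩
  by_contra! hlt
  exact hA q hq ((pow_dvd_pow q hlt).trans
    (hk ▸ AddSubgroup.card_addSubgroup_dvd_card (powTorsion A q)))

theorem card_powTorsion_ne_one {A : Type*} [AddCommGroup A] [Finite A] {q : ℕ} (hq : q.Prime)
    (hd : q ∣ Nat.card A) : Nat.card (powTorsion A q) ≠ 1 := by
  have := Fact.mk hq
  obtain ⟨a, ha⟩ := exists_prime_addOrderOf_dvd_card' q hd
  intro h1
  have h0 : a ∈ (⊥ : AddSubgroup A) := by
    rw [← AddSubgroup.card_eq_one.1 h1]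
    exact ⟨1, by rw [pow_one, ← ha, addOrderOf_nsmul_eq_zero]⟩
  rw [AddSubgroup.mem_bot.1 h0, addOrderOf_zero] at ha
  exact hq.one_lt.ne ha

/-- Primary decomposition, by splitting `n` into coprime factors and using Bézout. -/
theorem mem_of_powTorsion_le {A : Type*} [AddCommGroup A] (K : AddSubgroup A) (n : ℕ)
    (hK : ∀ q, q.Prime → q ∣ n → powTorsion A q ≤ K) (hn : n ≠ 0) (a : A) (ha : n • a = 0) :
    a ∈ K := by
  induction n using Nat.recOnPosPrimePosCoprime generalizing a with
  | zero => exact absurd rfl hn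
  | one =>
    rw [one_smul] at ha
    exact ha ▸ zero_mem K
  | prime_pow p n hp hn' => exact hK p hp (dvd_pow_self p hn'.ne') ⟨n, ha⟩
  | coprime m n hm hn' hc ihm ihn =>
    have e := Nat.gcd_eq_gcd_ab m n
    rw [hc.gcd_eq_one] at e
    have ea : a = m.gcdB n • (n • a) + m.gcdA n • (m • a) := by
      rw [← natCast_zsmul a n, ← natCast_zsmul a m, ← mul_smul, ← mul_smul, ← add_smul,
        mul_comm, add_comm, mul_comm (m.gcdA n), ← e, Nat.cast_one, one_smul]
    rw [ea]
    refine add_mem (K.zsmul_mem (ihm (fun q hq hd => hK q hq (hd.mul_right n)) (by omega) _ ?_) _)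
      (K.zsmul_mem (ihn (fun q hq hd => hK q hq (hd.mul_left m)) (by omega) _ ?_) _)
    · rw [← mul_smul, ha]
    · rw [← mul_smul, mul_comm, ha]

theorem eq_zero_of_mem_powTorsion {A : Type*} [AddCommGroup A] {p q : ℕ} (hpq : p.Coprime q)
    {a : A} (hp : a ∈ powTorsion A p) (hq : a ∈ powTorsion A q) : a = 0 := by
  obtain ⟨k, hk⟩ := hp
  obtain ⟨l, hl⟩ := hq
  rw [← addOrderOf_dvd_iff_nsmul_eq_zero] at hk hl
  rw [← AddMonoid.addOrderOf_eq_one_iff]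
  exact Nat.eq_one_of_dvd_coprimes (hpq.pow k l) hk hl

theorem smul_eq_of_forall_powTorsion {A H : Type*} [AddCommGroup A] [Finite A] [Monoid H]
    [DistribMulAction H A] (h : H)
    (hh : ∀ q, q.Prime → q ∣ Nat.card A → ∀ a ∈ powTorsion A q, h • a = a) (a : A) :
    h • a = a :=
  mem_of_powTorsion_le ((DistribSMul.toAddMonoidHom A h).eqLocus (AddMonoidHom.id A))
    (Nat.card A) hh Nat.card_pos.ne' a card_nsmul_eq_zero'

/-! ### Nontriviality of the socle. -/

namespace LeftBrace

variable {A : Type*} [LeftBrace A]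

open Adjoint

/-- The `q`-primary component of a brace, as a subgroup of the adjoint group. -/
def Adjoint.primary (A : Type*) [LeftBrace A] (q : ℕ) : Subgroup (Adjoint A) :=
  ofLeftIdeal (powTorsion A q) fun x _ ha => smul_mem_powTorsion x ha

instance (q : ℕ) : DistribMulAction (Adjoint A) (powTorsion A q) where
  smul x a := ⟨x • a.1, smul_mem_powTorsion x a.2⟩
  one_smul a := Subtype.ext (one_smul _ a.1)
  mul_smul x y a := Subtype.ext (mul_smul x y a.1)
  smul_zero x := Subtype.ext (smul_zero x)
  smul_add x a b := Subtype.ext (smul_add x a.1 b.1)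

/-- If the conjugate of `x ∈ A_p` by `y ∈ A_q` is again in `A_p`, then `x` fixes `y`. -/
theorem Adjoint.smul_val_eq_of_conj_mem {p q : ℕ} (hpq : p.Coprime q) {x y : Adjoint A}
    (hx : x ∈ primary A p) (hy : y ∈ primary A q) (hxy : y⁻¹ * x * y ∈ primary A p) :
    x • val y = val y := by
  have h : val (x * y) = val (y * (y⁻¹ * x * y)) := by
    congr 1
    group
  rw [val_mul, val_mul] at h
  have h' : val x - y • val (y⁻¹ * x * y) = val y - x • val y := by
    rw [sub_eq_sub_iff_add_eq_add, h]
  -- By `h'` this element lies in both `A_p` and `A_q`.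
  have h0 : val x - y • val (y⁻¹ * x * y) = 0 :=
    eq_zero_of_mem_powTorsion hpq (sub_mem hx (smul_mem_powTorsion y hxy))
      (h' ▸ sub_mem hy (smul_mem_powTorsion x hy))
  exact (sub_eq_zero.1 (h' ▸ h0)).symm

/-- A faithful action by automorphisms embeds `M` in the permutations of the three nonzero elements.
-/
theorem Adjoint.card_le_six_of_faithful [Finite A] {q : ℕ} (hq : Nat.card (powTorsion A q) = 4)
    (M : Subgroup (Adjoint A)) (hM : ∀ x ∈ M, (∀ a ∈ powTorsion A q, x • a = a) → x = 1) :
    Nat.card M ≤ 6 := by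
  let X := {a : powTorsion A q // a ≠ 0}
  have hX : Nat.card X = 3 := by
    classical
    have := Fintype.ofFinite (powTorsion A q)
    rw [Nat.card_eq_fintype_card, Fintype.card_subtype_compl, Fintype.card_subtype_eq,
      ← Nat.card_eq_fintype_card, hq]
  let f : M → Equiv.Perm X := fun x =>
    (MulAction.toPerm x.1).subtypeEquiv fun a => by
      rw [MulAction.toPerm_apply, ne_eq, ne_eq, smul_eq_zero_iff_eq]
  have hf : Function.Injective f := by
    intro x y hxy
    have key : ∀ a ∈ powTorsion A q, x.1 • a = y.1 • a := by
      intro a ha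
      by_cases h0 : a = 0
      · rw [h0, smul_zero, smul_zero]
      · have := DFunLike.congr_fun hxy ⟨⟨a, ha⟩, fun h => h0 (congrArg Subtype.val h)⟩
        exact congrArg (fun z : X => (z.1 : A)) this
    refine Subtype.ext (inv_mul_eq_one.1 (hM _ (mul_mem (inv_mem y.2) x.2) fun a ha => ?_)).symm
    rw [mul_smul, key a ha, inv_smul_smul]
  calc Nat.card M ≤ Nat.card (Equiv.Perm X) := Nat.card_le_card_of_injective f hf
    _ = 6 := by rw [Nat.card_perm, hX]; rfl

theorem sq_mem_of_card_le {G : Type*} [Group G] [Finite G] {S M : Subgroup G} (hSM : S ≤ M)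
    (h : Nat.card M ≤ 2 * Nat.card S) {x : G} (hx : x ∈ M) : x ^ 2 ∈ S := by
  have hmul := Subgroup.card_mul_index (S.subgroupOf M)
  rw [Nat.card_congr (Subgroup.subgroupOfEquivOfLe hSM).toEquiv] at hmul
  have hS : 0 < Nat.card S := Nat.card_pos
  have hM : 0 < Nat.card M := Nat.card_pos
  have h2 : (S.subgroupOf M).index ≤ 2 := by nlinarith
  have h0 : (S.subgroupOf M).index ≠ 0 := Subgroup.index_ne_zero_of_finite
  have : (⟨x, hx⟩ : M) ^ 2 ∈ S.subgroupOf M := by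
    obtain h1 | h1 : (S.subgroupOf M).index = 1 ∨ (S.subgroupOf M).index = 2 := by omega
    · rw [Subgroup.index_eq_one.1 h1]
      trivial
    · exact Subgroup.sq_mem_of_index_two h1 _
  exact this

theorem mem_of_sq_mem {G : Type*} [Group G] {S : Subgroup G} {x : G} {n : ℕ} (hn : Odd n)
    (hx : x ^ n = 1) (h2 : x ^ 2 ∈ S) : x ∈ S := by
  obtain ⟨m, rfl⟩ := hn
  rw [pow_succ, pow_mul] at hx
  rw [eq_inv_of_mul_eq_one_right hx]
  exact inv_mem (pow_mem h2 m)

theorem Adjoint.exists_ne_one_smul_eq [Finite A] [Nontrivial A] (hA : CubeFree (Nat.card A)) :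
    ∃ x : Adjoint A, x ≠ 1 ∧ ∀ a : A, x • a = a := by
  obtain ⟨p, hp, hpd, hmax⟩ : ∃ p, p.Prime ∧ p ∣ Nat.card A ∧
      ∀ q, q.Prime → q ∣ Nat.card A → q ≤ p := by
    have hne : (Nat.card A).primeFactors.Nonempty :=
      Nat.nonempty_primeFactors.2 Finite.one_lt_card
    refine ⟨_, Nat.prime_of_mem_primeFactors (Finset.max'_mem _ hne),
      Nat.dvd_of_mem_primeFactors (Finset.max'_mem _ hne), fun q hq hd => Finset.le_max' _ _ ?_⟩
    exact Nat.mem_primeFactors.2 ⟨hq, hd, Nat.card_pos.ne'⟩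
  have := Fact.mk hp
  obtain ⟨k, hk, hPk⟩ := exists_card_powTorsion_of_cubeFree hA hp
  have hk0 : k ≠ 0 := fun h => card_powTorsion_ne_one hp hpd (by rw [hPk, h, pow_zero])
  have hPG : IsPGroup p (primary A p) := IsPGroup.of_card hPk
  obtain ⟨⟨s, hs⟩, hs1, hsP⟩ := exists_ne_one_smul_eq_of_card_eq
    (H := primary A p) (B := powTorsion A p) hPk hPk hk0 hk
  replace hs1 : s ≠ 1 := fun h => hs1 (Subtype.ext h)
  replace hsP : ∀ a ∈ powTorsion A p, s • a = a := fun a ha =>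
    congrArg Subtype.val (hsP ⟨a, ha⟩)
  have hother : ∀ q, q.Prime → q ∣ Nat.card A → q ≠ p →
      ¬ (q = 2 ∧ p = 3 ∧ Nat.card (powTorsion A q) = 4) →
      ∀ a ∈ powTorsion A q, s • a = a := by
    intro q hq hd hne hex a ha
    obtain ⟨l, hl, hQ⟩ := exists_card_powTorsion_of_cubeFree hA hq
    refine congrArg Subtype.val (smul_eq_of_isPGroup_of_card_le_sq hq
      (lt_of_le_of_ne (hmax q hq hd) hne) hPG hQ hl ?_ ⟨s, hs⟩ (⟨a, ha⟩ : powTorsion A q))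
    rintro ⟨rfl, rfl, rfl⟩
    exact hex ⟨rfl, rfl, hQ⟩
  by_cases hex : p = 3 ∧ Nat.card (powTorsion A 2) = 4
  swap
  · refine ⟨s, hs1, smul_eq_of_forall_powTorsion s fun q hq hd => ?_⟩
    rcases eq_or_ne q p with rfl | hne
    · exact hsP
    · refine hother q hq hd hne ?_
      rintro ⟨rfl, h3, h4⟩
      exact hex ⟨h3, h4⟩
  obtain ⟨rfl, h4⟩ := hex
  have hpr : ∀ q, q.Prime → q ∣ Nat.card A → q = 2 ∨ q = 3 := by
    intro q hq hd
    have := hmax q hq hd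
    have := hq.two_le
    omega
  by_contra! hcon
  have hfaith : ∀ x : Adjoint A, (∀ a ∈ powTorsion A 3, x • a = a) →
      (∀ a ∈ powTorsion A 2, x • a = a) → x = 1 := by
    intro x h3 h2
    by_contra hx
    obtain ⟨a, ha⟩ := hcon x hx
    refine ha (smul_eq_of_forall_powTorsion x (fun q hq hd => ?_) a)
    rcases hpr q hq hd with rfl | rfl
    exacts [h2, h3]
  let M : Subgroup (Adjoint A) := (MulAction.toPermHom (Adjoint A) (powTorsion A 3)).ker
  have hM : ∀ x, x ∈ M ↔ ∀ a ∈ powTorsion A 3, x • a = a := by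
    intro x
    rw [MonoidHom.mem_ker, Equiv.Perm.ext_iff]
    exact ⟨fun h a ha => congrArg Subtype.val (h ⟨a, ha⟩), fun h a => Subtype.ext (h a a.2)⟩
  have hM6 : Nat.card M ≤ 6 := card_le_six_of_faithful h4 M fun x hx h2 =>
    hfaith x ((hM x).1 hx) h2
  let S := M ⊓ primary A 3
  have hsS : s ∈ S := ⟨(hM s).2 hsP, hs⟩
  have hS3 : 3 ≤ Nat.card S := by
    obtain ⟨j, hj⟩ := IsPGroup.iff_card.1 (hPG.to_le (inf_le_right : S ≤ _))
    have h1 : Nat.card S ≠ 1 := fun h => hs1 (by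
      rw [Subgroup.card_eq_one.1 h] at hsS
      exact Subgroup.mem_bot.1 hsS)
    rw [hj] at h1 ⊢
    exact Nat.le_self_pow (by rintro rfl; exact h1 rfl) 3
  refine hs1 (hfaith s hsP fun y hy => ?_)
  refine smul_val_eq_of_conj_mem (q := 2) (y := of y) (by norm_num) hs hy ?_
  obtain ⟨m, hm⟩ := hPG ⟨s, hs⟩
  replace hm : s ^ 3 ^ m = 1 := congrArg Subtype.val hm
  have hconj : (of y)⁻¹ * s * of y ∈ M := by
    simpa using (inferInstance : M.Normal).conj_mem s hsS.1 (of y)⁻¹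
  -- The conjugate has odd order and its square lies in `S`, since `|M| ≤ 6 ≤ 2 |S|`.
  refine (mem_of_sq_mem (S := S) (n := 3 ^ m) (Odd.pow (by decide)) ?_
    (sq_mem_of_card_le inf_le_left (hM6.trans (Nat.mul_le_mul_left 2 hS3)) hconj)).2
  have := conj_pow (i := 3 ^ m) (a := (of y)⁻¹) (b := s)
  rw [inv_inv] at this
  rw [this, hm, mul_one, inv_mul_cancel]

theorem socle_ne_singleton_zero [Finite A] [Nontrivial A] (hA : CubeFree (Nat.card A)) :
    socle A ≠ {0} := by
  obtain ⟨x, hx1, hx⟩ := exists_ne_one_smul_eq hA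
  intro h
  have : val x ∈ socle A := (mem_socle_iff x).2 hx
  rw [h] at this
  exact hx1 this

/-! ### The quotient by the socle. -/

variable (A) in
/-- The socle as an additive subgroup. -/
def socleAddSubgroup : AddSubgroup A where
  carrier := socle A
  zero_mem' := zero_mul'
  add_mem' {a b} ha hb := by
    have h : a + b = val (of a * of b) := by
      rw [val_mul, (mem_socle_iff (of a)).1 ha]
      rfl
    rw [h, mem_socle_iff]
    intro c
    rw [mul_smul, (mem_socle_iff (of b)).1 hb, (mem_socle_iff (of a)).1 ha]
  neg_mem' {a} ha := by
    have hi : ∀ c : A, (of a)⁻¹ • c = c := fun c =>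
      inv_smul_eq_iff.2 ((mem_socle_iff (of a)).1 ha c).symm
    have h : -a = val (of a)⁻¹ := by
      rw [val_inv, hi]
      rfl
    rw [h, mem_socle_iff]
    exact hi

/-- For `s` in the socle, `s + a = s ∘ a`, and `s` acts trivially. -/
theorem add_mul_of_mem_socle {s : A} (hs : s ∈ socleAddSubgroup A) (a b : A) :
    (s + a) * b = a * b := by
  have h : s + a = val (of s * of a) := by
    rw [val_mul, (mem_socle_iff (of s)).1 hs]
    rfl
  have h2 : (s + a) * b + b = a * b + b := by
    rw [h]
    exact (mul_smul (of s) (of a) b).trans ((mem_socle_iff (of s)).1 hs _)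
  exact add_right_cancel h2

/-- The conjugate of `s` by `a` in the adjoint group lies in the kernel of the action and equals `a
• s = a * s + s`. -/
theorem mul_mem_socle (a : A) {s : A} (hs : s ∈ socleAddSubgroup A) :
    a * s ∈ socleAddSubgroup A := by
  have ht : ∀ c : A, (of a * of s * (of a)⁻¹) • c = c := fun c => by
    rw [mul_smul, mul_smul, (mem_socle_iff (of s)).1 hs, smul_inv_smul]
  have h : val (of a * of s * (of a)⁻¹) = of a • s := by
    have h1 : val (of a * of s * (of a)⁻¹ * of a) = val (of a * of s) := by
      rw [inv_mul_cancel_right]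
    rw [val_mul _ (of a), val_mul (of a), ht, add_comm] at h1
    exact add_left_cancel h1
  have h2 : of a • s ∈ socleAddSubgroup A := h ▸ (mem_socle_iff _).2 ht
  have h3 : a * s = of a • s - s := (add_sub_cancel_right _ _).symm
  exact h3 ▸ sub_mem h2 hs

instance : Mul (A ⧸ socleAddSubgroup A) :=
  ⟨Quotient.map₂ (· * ·) fun a a' ha b b' hb => by
    replace ha := QuotientAddGroup.leftRel_apply.1 ha
    replace hb := QuotientAddGroup.leftRel_apply.1 hb
    refine QuotientAddGroup.leftRel_apply.2 ?_
    have h1 : a' * b' = a * b' := by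
      have := add_mul_of_mem_socle ha a b'
      rwa [neg_add_cancel_comm] at this
    have h2 : a * b' = a * (-b + b') + a * b := by
      rw [← left_distributive, neg_add_cancel_comm]
    rw [h1, h2, neg_add_eq_sub, add_sub_cancel_right]
    exact mul_mem_socle a hb⟩

instance : LeftBrace (A ⧸ socleAddSubgroup A) where
  left_distributive a b c := by
    induction a using QuotientAddGroup.induction_on with | H a
    induction b using QuotientAddGroup.induction_on with | H b
    induction c using QuotientAddGroup.induction_on with | H c
    exact congrArg QuotientAddGroup.mk (left_distributive a b c)
  circ_assoc a b c := by
    induction a using QuotientAddGroup.induction_on with | H a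
    induction b using QuotientAddGroup.induction_on with | H b
    induction c using QuotientAddGroup.induction_on with | H c
    exact congrArg QuotientAddGroup.mk (circ_assoc a b c)
  circ_identity_inverse := by
    obtain ⟨e, he, hi⟩ := circ_identity_inverse (A := A)
    refine ⟨(e : A ⧸ socleAddSubgroup A), fun a => ?_, fun a => ?_⟩ <;>
      induction a using QuotientAddGroup.induction_on with | H a
    · exact ⟨congrArg QuotientAddGroup.mk (he a).1, congrArg QuotientAddGroup.mk (he a).2⟩
    · obtain ⟨b, h1, h2⟩ := hi a
      exact ⟨b, congrArg QuotientAddGroup.mk h1, congrArg QuotientAddGroup.mk h2⟩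

theorem mk_mem_rightChain (n : ℕ) {a : A} (ha : a ∈ rightChain A n) :
    (a : A ⧸ socleAddSubgroup A) ∈ rightChain (A ⧸ socleAddSubgroup A) n := by
  induction n generalizing a with
  | zero => trivial
  | succ n ih =>
    have hle : rightChain A (n + 1) ≤ (rightChain (A ⧸ socleAddSubgroup A) (n + 1)).comap
        (QuotientAddGroup.mk' (socleAddSubgroup A)) := by
      refine (AddSubgroup.closure_le _).2 ?_
      rintro _ ⟨x, hx, b, rfl⟩
      exact AddSubgroup.subset_closure ⟨x, ih hx, b, rfl⟩
    exact hle ha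

theorem HasFiniteMultipermutationLevel.of_quotient_socle
    (h : HasFiniteMultipermutationLevel (A ⧸ socleAddSubgroup A)) :
    HasFiniteMultipermutationLevel A := by
  obtain ⟨n, hn⟩ := h
  -- Vanishing in the quotient puts `rightChain A n` inside the socle; one more product kills it.
  refine ⟨n + 1, AddSubgroup.closure_eq_bot_iff.2 ?_⟩
  rintro _ ⟨x, hx, b, rfl⟩
  have h0 := mk_mem_rightChain n hx
  rw [hn, AddSubgroup.mem_bot, QuotientAddGroup.eq_zero_iff] at h0
  exact h0 b

end LeftBrace

/-! ### Induction on the order. -/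

theorem CubeFree.of_dvd {m n : ℕ} (h : CubeFree n) (hmn : m ∣ n) : CubeFree m :=
  fun p hp hd => h p hp (hd.trans hmn)

theorem LeftBrace.hasFiniteMultipermutationLevel_of_cubeFree (n : ℕ) (A : Type*) [LeftBrace A]
    [Finite A] (hn : Nat.card A = n) (hA : CubeFree (Nat.card A)) :
    HasFiniteMultipermutationLevel A := by
  induction n using Nat.strong_induction_on generalizing A with
  | _ n ih =>
    rcases subsingleton_or_nontrivial A with hs | hs
    · exact ⟨0, Subsingleton.elim _ _⟩
    · have hmul := AddSubgroup.card_eq_card_quotient_mul_card_addSubgroup (socleAddSubgroup A)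
      have h1 : 1 < Nat.card (socleAddSubgroup A) := by
        rw [AddSubgroup.one_lt_card_iff_ne_bot]
        exact fun h => socle_ne_singleton_zero hA (congrArg (fun I : AddSubgroup A => (I : Set A)) h)
      refine .of_quotient_socle (ih (Nat.card (A ⧸ socleAddSubgroup A)) ?_ _ rfl
        (hA.of_dvd ⟨_, hmul⟩))
      rw [← hn, hmul]
      exact lt_mul_of_one_lt_right Nat.card_pos h1

theorem corollary1p4 {A : Type*} [LeftBrace A] [Finite A] (hA : CubeFree (Nat.card A)) :
    (Nontrivial A → LeftBrace.socle A ≠ {0}) ∧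
      LeftBrace.HasFiniteMultipermutationLevel A :=
  ⟨fun _ => LeftBrace.socle_ne_singleton_zero hA,
    LeftBrace.hasFiniteMultipermutationLevel_of_cubeFree _ A rfl hA⟩
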